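/- Let $(\mathcal X,\mathsf d)$ be a separable metric space with Borel $\sigma$-algebra $\mathfrak B(\mathcal X)$, let $\mu$ be a Borel probability measure on $\mathcal X\times\{0,1\}$, and let $\varepsilon>0$. Put $w_i:=\mu(\mathcal X\times\{i\})$ and, for $i\in\{0,1\}$ with $w_i>0$, $\rho_i(A):=\mu(A\times\{i\})/w_i$ (terms with $w_i=0$ are read as $0$). With the open balls $B_\varepsilon(x)=\{\tilde x:\mathsf d(x,\tilde x)<\varepsilon\}$ define, for $A\in\mathfrak B(\mathcal X)$, $$\widetilde{\operatorname{Per}}_\varepsilon(A;\mu):=\frac{w_0}{\varepsilon}\int_{\mathcal X}\Big(\sup_{\tilde x\in B_\varepsilon(x)}1_A(\tilde x)-1_A(x)\Big)\,d\rho_0(x)+\frac{w_1}{\varepsilon}\int_{\mathcal X}\Big(1_A(x)-\inf_{\tilde x\in B_\varepsilon(x)}1_A(\tilde x)\Big)\,d\rho_1(x).$$ For a Borel measure $\nu$ on $\mathcal X$ and $A,B\in\mathfrak B(\mathcal X)$ write $A\sim_\nu B$ if $\nu(A\triangle B)=0$, write $A\preceq_\nu B$ if $1_A\le 1_B$ holds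 $\nu$-a.e., and set $$\operatorname{Per}^\nu_\varepsilon(A;\mu):=\inf\{\widetilde{\operatorname{Per}}_\varepsilon(B;\mu):B\in\mathfrak B(\mathcal X),\ A\sim_\nu B\}.$$ A set $A\in\mathfrak B(\mathcal X)$ is a solution of the perimeter-regularized problem $$\inf_{A\in\mathfrak B(\mathcal X)}\ \mathbb E_{(x,y)\sim\mu}\big[|1_A(x)-y|\big]+\varepsilon\operatorname{Per}^\nu_\varepsilon(A;\mu)\tag{P}$$ if it attains the infimum. A solution $A$ is called maximal (respectively minimal) if every solution $A'$ with $A\preceq_\nu A'$ (respectively $A'\preceq_\nu A$) satisfies $A\sim_\nu A'$. Proposition. Let $\nu$ be a finite Borel measure on $\mathcal X$. Then (P) has a maximal solution $A_{\max}$, and every maximal solution $A'$ satisfies $A'\sim_\nu A_{\max}$. Likewise, (P) has a minimal solution $A_{\min}$, and every minimal solution $A'$ satisfies $A'\sim_\nu A_{\min}$. -/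

import Mathlib

open MeasureTheory Set
open scoped symmDiff

noncomputable section

namespace AdvTraining

/-- The real-valued indicator function of a set `A`. -/
def ind {X : Type*} (A : Set X) : X → ℝ := A.indicator (fun _ => (1 : ℝ))

/-- The equivalence `A ∼_ν B`: the symmetric difference is a `ν`-null set. -/
def NuEquiv {X : Type*} [MeasurableSpace X] (ν : Measure X) (A B : Set X) : Prop :=
  ν (A ∆ B) = 0

/-- The order `A ⪯_ν B`: `1_A ≤ 1_B` holds `ν`-almost everywhere. -/
def NuLE {X : Type*} [MeasurableSpace X] (ν : Measure X) (A B : Set X) : Prop :=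
  ∀ᵐ x ∂ν, ind A x ≤ ind B x

/-- The class probability `w_i = μ (X × {i})`. -/
def classProb {X : Type*} [MeasurableSpace X] (μ : Measure (X × Fin 2)) (i : Fin 2) : ℝ :=
  (μ (univ ×ˢ {i})).toReal

/-- The conditional distribution `ρ_i (A) = μ (A × {i}) / w_i`. If `w_i = 0` this is the zero
measure; it is only ever used multiplied by `w_i`. -/
def condDist {X : Type*} [MeasurableSpace X] (μ : Measure (X × Fin 2)) (i : Fin 2) : Measure X :=
  (μ (univ ×ˢ {i}))⁻¹ • (μ.restrict (univ ×ˢ {i})).map Prod.fst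

/-- The unregularized risk `E_{(x,y) ∼ μ} |1_A(x) - y|`. -/
def risk {X : Type*} [MeasurableSpace X] (μ : Measure (X × Fin 2)) (A : Set X) : ℝ :=
  ∫ p, |ind A p.1 - ((p.2 : ℕ) : ℝ)| ∂μ

/-- The nonlocal pre-perimeter of `A` with parameter `ε`, with open balls. -/
def prePer {X : Type*} [MetricSpace X] [MeasurableSpace X]
    (ε : ℝ) (μ : Measure (X × Fin 2)) (A : Set X) : ℝ :=
  classProb μ 0 / ε *
      ∫ x, ((⨆ z : Metric.ball x ε, ind A (z : X)) - ind A x) ∂(condDist μ 0) +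
    classProb μ 1 / ε *
      ∫ x, (ind A x - ⨅ z : Metric.ball x ε, ind A (z : X)) ∂(condDist μ 1)

/-- The nonlocal perimeter with respect to `ν`: the infimum of the pre-perimeter over all Borel
sets that are `ν`-equivalent to `A`. -/
def per {X : Type*} [MetricSpace X] [MeasurableSpace X]
    (ν : Measure X) (ε : ℝ) (μ : Measure (X × Fin 2)) (A : Set X) : ℝ :=
  ⨅ B : {B : Set X // MeasurableSet B ∧ NuEquiv ν A B}, prePer ε μ (B : Set X)

/-- The objective of the perimeter-regularized problem. -/
def objective {X : Type*} [MetricSpace X] [MeasurableSpace X]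
    (ν : Measure X) (ε : ℝ) (μ : Measure (X × Fin 2)) (A : Set X) : ℝ :=
  risk μ A + ε * per ν ε μ A

/-- `A` is a solution of the perimeter-regularized problem: a Borel set that minimizes the
objective among all Borel sets. -/
def IsSolution {X : Type*} [MetricSpace X] [MeasurableSpace X]
    (ν : Measure X) (ε : ℝ) (μ : Measure (X × Fin 2)) (A : Set X) : Prop :=
  MeasurableSet A ∧ ∀ A' : Set X, MeasurableSet A' → objective ν ε μ A ≤ objective ν ε μ A'

/-- A maximal solution of the perimeter-regularized problem. -/
def IsMaximalSolution {X : Type*} [MetricSpace X] [MeasurableSpace X]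
    (ν : Measure X) (ε : ℝ) (μ : Measure (X × Fin 2)) (A : Set X) : Prop :=
  IsSolution ν ε μ A ∧ ∀ A' : Set X, IsSolution ν ε μ A' → NuLE ν A A' → NuEquiv ν A A'

/-- A minimal solution of the perimeter-regularized problem. -/
def IsMinimalSolution {X : Type*} [MetricSpace X] [MeasurableSpace X]
    (ν : Measure X) (ε : ℝ) (μ : Measure (X × Fin 2)) (A : Set X) : Prop :=
  IsSolution ν ε μ A ∧ ∀ A' : Set X, IsSolution ν ε μ A' → NuLE ν A' A → NuEquiv ν A A'

end AdvTraining

end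

/-!
The objective is a nonnegative set functional that is submodular and lower semicontinuous along
monotone sequences. For the pre-perimeter this rests on the fact that thickening commutes with
unions but only satisfies `thickening (A ∩ B) ⊆ thickening A ∩ thickening B`; passing to the infimum
over `ν`-equivalence classes preserves all three properties.

Such a functional `Φ` attains its minimum over every nonempty family of measurable sets closed under
countable unions and intersections: if `Φ (Bₙ) ≤ inf Φ + δₙ` with `δ` summable, then submodularity
bounds `Φ (⋃ n ≥ k, Bₙ)` by `inf Φ + ∑ n ≥ k, δₙ`, so `limsup Bₙ` is a minimizer. The minimizers
form again such a family, and minimizing `A ↦ ν (Aᶜ)` over it produces the minimizer that is largest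
up to `ν`-null sets. Taking complements produces the smallest one.
-/

namespace AdvTraining

open Filter Topology

/-- The inequality `a ≤ liminf u` along the filter `l`. It is spelled out because the real-valued
`Filter.liminf` takes a junk value when `u` is unbounded. -/
def LeLiminf {ι : Type*} (a : ℝ) (u : ι → ℝ) (l : Filter ι) : Prop :=
  ∀ c < a, ∀ᶠ i in l, c < u i

namespace LeLiminf

variable {ι : Type*} {l : Filter ι} {a b : ℝ} {u v : ι → ℝ}

theorem of_tendsto (h : Tendsto u l (𝓝 a)) : LeLiminf a u l :=
  fun _ hc => h.eventually_const_lt hc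

theorem mono (h : LeLiminf a u l) (huv : ∀ i, u i ≤ v i) : LeLiminf a v l :=
  fun c hc => (h c hc).mono fun i hi => hi.trans_le (huv i)

theorem le_of_tendsto [l.NeBot] (h : LeLiminf a u l) (hu : Tendsto u l (𝓝 b)) : a ≤ b :=
  le_of_forall_lt_imp_le_of_dense fun c hc =>
    ge_of_tendsto hu ((h c hc).mono fun _ => le_of_lt)

theorem add (hu : LeLiminf a u l) (hv : LeLiminf b v l) :
    LeLiminf (a + b) (fun i => u i + v i) l := by
  intro c hc
  filter_upwards [hu (a - (a + b - c) / 2) (by linarith),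
    hv (b - (a + b - c) / 2) (by linarith)] with i hui hvi
  linarith

theorem const_mul {r : ℝ} (hr : 0 ≤ r) (hu : LeLiminf a u l) :
    LeLiminf (r * a) (fun i => r * u i) l := by
  intro c hc
  rcases hr.eq_or_lt with rfl | hr
  · exact Eventually.of_forall fun i => by simpa using hc
  · filter_upwards [hu (c / r) ((div_lt_iff₀' hr).2 hc)] with i hi
    exact (div_lt_iff₀' hr).1 hi

end LeLiminf

variable {X : Type*} [MeasurableSpace X]

/-- A family of measurable sets closed under countable unions and countable intersections. -/
structure IsSigmaLattice (F : Set (Set X)) : Prop where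
  measurableSet : ∀ {A : Set X}, A ∈ F → MeasurableSet A
  iUnion_mem : ∀ {B : ℕ → Set X}, (∀ n, B n ∈ F) → (⋃ n, B n) ∈ F
  iInter_mem : ∀ {B : ℕ → Set X}, (∀ n, B n ∈ F) → (⋂ n, B n) ∈ F

namespace IsSigmaLattice

variable {F : Set (Set X)} {A A' : Set X} {B : ℕ → Set X}

theorem union_mem (hF : IsSigmaLattice F) (hA : A ∈ F) (hA' : A' ∈ F) : A ∪ A' ∈ F := by
  have h := hF.iUnion_mem (B := fun n => n.casesOn A fun _ => A') (by rintro (_ | _) <;> assumption)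
  rw [← union_iUnion_nat_succ, iUnion_const] at h
  exact h

theorem inter_mem (hF : IsSigmaLattice F) (hA : A ∈ F) (hA' : A' ∈ F) : A ∩ A' ∈ F := by
  have h := hF.iInter_mem (B := fun n => n.casesOn A fun _ => A') (by rintro (_ | _) <;> assumption)
  rw [← inter_iInter_nat_succ, iInter_const] at h
  exact h

theorem accumulate_mem (hF : IsSigmaLattice F) (hB : ∀ n, B n ∈ F) (n : ℕ) :
    accumulate B n ∈ F := by
  induction n with
  | zero => simpa only [accumulate_zero_nat] using hB 0
  | succ n ih =>
    rw [accumulate_succ]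
    exact hF.union_mem ih (hB _)

end IsSigmaLattice

theorem isSigmaLattice_measurableSet : IsSigmaLattice {A : Set X | MeasurableSet A} where
  measurableSet hA := hA
  iUnion_mem hB := .iUnion hB
  iInter_mem hB := .iInter hB

theorem isSigmaLattice_ae_eq (ν : Measure X) (A : Set X) :
    IsSigmaLattice {B : Set X | MeasurableSet B ∧ A =ᵐ[ν] B} where
  measurableSet hB := hB.1
  iUnion_mem hB := ⟨.iUnion fun n => (hB n).1, by
    simpa only [iUnion_const] using
      Filter.EventuallyEq.countable_iUnion (s := fun _ => A) fun n => (hB n).2⟩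
  iInter_mem hB := ⟨.iInter fun n => (hB n).1, by
    simpa only [iInter_const] using
      Filter.EventuallyEq.countable_iInter (s := fun _ => A) fun n => (hB n).2⟩

/-- A set functional that, on measurable sets, is nonnegative, submodular, and lower semicontinuous
along monotone sequences in both directions. These are the properties from which the existence of
extremal minimizers is derived. -/
structure SubmodularLSC (Φ : Set X → ℝ) : Prop where
  nonneg : ∀ {A : Set X}, MeasurableSet A → 0 ≤ Φ A
  union_add_inter_le : ∀ {A B : Set X}, MeasurableSet A → MeasurableSet B →
    Φ (A ∪ B) + Φ (A ∩ B) ≤ Φ A + Φ B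
  leLiminf_iUnion : ∀ {B : ℕ → Set X}, (∀ n, MeasurableSet (B n)) → Monotone B →
    LeLiminf (Φ (⋃ n, B n)) (fun n => Φ (B n)) atTop
  leLiminf_iInter : ∀ {B : ℕ → Set X}, (∀ n, MeasurableSet (B n)) → Antitone B →
    LeLiminf (Φ (⋂ n, B n)) (fun n => Φ (B n)) atTop

/-- The measurable sets at which a set functional attains its minimum over all measurable sets. -/
def minimizers (Φ : Set X → ℝ) : Set (Set X) :=
  {A | MeasurableSet A ∧ ∀ B, MeasurableSet B → Φ A ≤ Φ B}

theorem compl_mem_minimizers {Φ : Set X → ℝ} {A : Set X} :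
    Aᶜ ∈ minimizers (fun B => Φ Bᶜ) ↔ A ∈ minimizers Φ := by
  refine ⟨fun h => ⟨h.1.of_compl, fun B hB => ?_⟩, fun h => ⟨h.1.compl, fun B hB => ?_⟩⟩
  · simpa only [compl_compl] using h.2 Bᶜ hB.compl
  · simpa only [compl_compl] using h.2 Bᶜ hB.compl

namespace SubmodularLSC

variable {Φ Ψ : Set X → ℝ}

theorem congr (hΦ : SubmodularLSC Φ) (h : ∀ A, MeasurableSet A → Ψ A = Φ A) :
    SubmodularLSC Ψ where
  nonneg hA := h _ hA ▸ hΦ.nonneg hA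
  union_add_inter_le hA hB := by
    rw [h _ (hA.union hB), h _ (hA.inter hB), h _ hA, h _ hB]
    exact hΦ.union_add_inter_le hA hB
  leLiminf_iUnion hB hmono := by
    simp_rw [h _ (hB _), h _ (MeasurableSet.iUnion hB)]
    exact hΦ.leLiminf_iUnion hB hmono
  leLiminf_iInter hB hanti := by
    simp_rw [h _ (hB _), h _ (MeasurableSet.iInter hB)]
    exact hΦ.leLiminf_iInter hB hanti

theorem add (hΦ : SubmodularLSC Φ) (hΨ : SubmodularLSC Ψ) :
    SubmodularLSC (fun A => Φ A + Ψ A) where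
  nonneg hA := add_nonneg (hΦ.nonneg hA) (hΨ.nonneg hA)
  union_add_inter_le hA hB := by
    linarith [hΦ.union_add_inter_le hA hB, hΨ.union_add_inter_le hA hB]
  leLiminf_iUnion hB hmono := (hΦ.leLiminf_iUnion hB hmono).add (hΨ.leLiminf_iUnion hB hmono)
  leLiminf_iInter hB hanti := (hΦ.leLiminf_iInter hB hanti).add (hΨ.leLiminf_iInter hB hanti)

theorem const_mul {r : ℝ} (hr : 0 ≤ r) (hΦ : SubmodularLSC Φ) :
    SubmodularLSC (fun A => r * Φ A) where
  nonneg hA := mul_nonneg hr (hΦ.nonneg hA)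
  union_add_inter_le hA hB := by
    simpa only [mul_add] using mul_le_mul_of_nonneg_left (hΦ.union_add_inter_le hA hB) hr
  leLiminf_iUnion hB hmono := (hΦ.leLiminf_iUnion hB hmono).const_mul hr
  leLiminf_iInter hB hanti := (hΦ.leLiminf_iInter hB hanti).const_mul hr

theorem compl (hΦ : SubmodularLSC Φ) : SubmodularLSC (fun A => Φ Aᶜ) where
  nonneg hA := hΦ.nonneg hA.compl
  union_add_inter_le hA hB := by
    rw [compl_union, compl_inter, add_comm]
    exact hΦ.union_add_inter_le hA.compl hB.compl
  leLiminf_iUnion hB hmono := by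
    rw [compl_iUnion]
    exact hΦ.leLiminf_iInter (fun n => (hB n).compl) fun _ _ h => compl_subset_compl.2 (hmono h)
  leLiminf_iInter hB hanti := by
    rw [compl_iInter]
    exact hΦ.leLiminf_iUnion (fun n => (hB n).compl) fun _ _ h => compl_subset_compl.2 (hanti h)

section Minimization

variable {F : Set (Set X)} {I : ℝ} {δ : ℕ → ℝ} {B : ℕ → Set X}

theorem accumulate_le_add_sum (hΦ : SubmodularLSC Φ) (hF : IsSigmaLattice F)
    (hI : ∀ A ∈ F, I ≤ Φ A) (hB : ∀ n, B n ∈ F) (hδ : ∀ n, Φ (B n) ≤ I + δ n) (n : ℕ) :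
    Φ (accumulate B n) ≤ I + ∑ i ∈ Finset.range (n + 1), δ i := by
  induction n with
  | zero => simpa using hδ 0
  | succ n ih =>
    have hacc := hF.accumulate_mem hB n
    rw [accumulate_succ, Finset.sum_range_succ]
    linarith [hδ (n + 1), hI _ (hF.inter_mem hacc (hB (n + 1))),
      hΦ.union_add_inter_le (hF.measurableSet hacc) (hF.measurableSet (hB (n + 1)))]

theorem iUnion_le_add_tsum (hΦ : SubmodularLSC Φ) (hF : IsSigmaLattice F)
    (hI : ∀ A ∈ F, I ≤ Φ A) (hB : ∀ n, B n ∈ F) (hδ : ∀ n, Φ (B n) ≤ I + δ n)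
    (hsum : Summable δ) : Φ (⋃ n, B n) ≤ I + ∑' n, δ n := by
  have hδ_nonneg : ∀ n, 0 ≤ δ n := fun n => by linarith [hI _ (hB n), hδ n]
  have hacc : ∀ n, Φ (accumulate B n) ≤ I + ∑' n, δ n := fun n =>
    (hΦ.accumulate_le_add_sum hF hI hB hδ n).trans
      (by gcongr; exact hsum.sum_le_tsum _ fun i _ => hδ_nonneg i)
  rw [← iUnion_accumulate]
  exact ((hΦ.leLiminf_iUnion (fun n => hF.measurableSet (hF.accumulate_mem hB n))
    monotone_accumulate).mono hacc).le_of_tendsto tendsto_const_nhds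

theorem limsup_le (hΦ : SubmodularLSC Φ) (hF : IsSigmaLattice F)
    (hI : ∀ A ∈ F, I ≤ Φ A) (hB : ∀ n, B n ∈ F) (hδ : ∀ n, Φ (B n) ≤ I + δ n)
    (hsum : Summable δ) : Φ (⋂ k, ⋃ n, B (n + k)) ≤ I := by
  have htail : ∀ k, Φ (⋃ n, B (n + k)) ≤ I + ∑' n, δ (n + k) := fun k =>
    hΦ.iUnion_le_add_tsum hF hI (fun n => hB (n + k)) (fun n => hδ (n + k))
      ((summable_nat_add_iff k).2 hsum)
  have htail_anti : Antitone fun k => ⋃ n, B (n + k) := fun j k hjk => by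
    simp_rw [← iUnion_ge_eq_iUnion_nat_add B]
    exact biUnion_subset_biUnion_left fun n hn => le_trans hjk hn
  have hlim : Tendsto (fun k => I + ∑' n, δ (n + k)) atTop (𝓝 I) := by
    simpa only [add_zero] using (tendsto_sum_nat_add δ).const_add I
  exact ((hΦ.leLiminf_iInter (fun k => hF.measurableSet (hF.iUnion_mem fun n => hB (n + k)))
    htail_anti).mono htail).le_of_tendsto hlim

theorem exists_forall_le (hΦ : SubmodularLSC Φ) (hF : IsSigmaLattice F) (hne : F.Nonempty) :
    ∃ C ∈ F, ∀ A ∈ F, Φ C ≤ Φ A := by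
  have hbdd : BddBelow (Φ '' F) :=
    ⟨0, forall_mem_image.2 fun A hA => hΦ.nonneg (hF.measurableSet hA)⟩
  have hI : ∀ A ∈ F, sInf (Φ '' F) ≤ Φ A := fun A hA => csInf_le hbdd (mem_image_of_mem Φ hA)
  have hseq : ∀ n : ℕ, ∃ B ∈ F, Φ B ≤ sInf (Φ '' F) + (1 / 2) ^ n := fun n => by
    obtain ⟨_, ⟨B, hB, rfl⟩, h⟩ := exists_lt_of_csInf_lt (hne.image Φ)
      (lt_add_of_pos_right (sInf (Φ '' F)) (show (0 : ℝ) < (1 / 2) ^ n by positivity))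
    exact ⟨B, hB, h.le⟩
  choose B hB hδ using hseq
  exact ⟨_, hF.iInter_mem fun k => hF.iUnion_mem fun n => hB (n + k), fun A hA =>
    (hΦ.limsup_le hF hI hB hδ summable_geometric_two).trans (hI A hA)⟩

end Minimization

theorem nonempty_minimizers (hΦ : SubmodularLSC Φ) : (minimizers Φ).Nonempty :=
  hΦ.exists_forall_le isSigmaLattice_measurableSet ⟨∅, MeasurableSet.empty⟩

theorem iUnion_mem_minimizers (hΦ : SubmodularLSC Φ) {B : ℕ → Set X}
    (hB : ∀ n, B n ∈ minimizers Φ) : (⋃ n, B n) ∈ minimizers Φ := by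
  refine ⟨.iUnion fun n => (hB n).1, fun C hC => ?_⟩
  have h := hΦ.iUnion_le_add_tsum isSigmaLattice_measurableSet (δ := 0) (hB 0).2
    (fun n => (hB n).1) (fun n => by simpa using (hB n).2 _ (hB 0).1) summable_zero
  simp only [Pi.zero_apply, tsum_zero, add_zero] at h
  exact h.trans ((hB 0).2 C hC)

theorem isSigmaLattice_minimizers (hΦ : SubmodularLSC Φ) : IsSigmaLattice (minimizers Φ) where
  measurableSet hA := hA.1
  iUnion_mem hB := hΦ.iUnion_mem_minimizers hB
  iInter_mem hB := by
    rw [← compl_mem_minimizers, compl_iInter]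
    exact hΦ.compl.iUnion_mem_minimizers fun n => compl_mem_minimizers.2 (hB n)

end SubmodularLSC

theorem tendsto_measureReal_iUnion_atTop (m : Measure X) [IsFiniteMeasure m] {B : ℕ → Set X}
    (hmono : Monotone B) : Tendsto (fun n => m.real (B n)) atTop (𝓝 (m.real (⋃ n, B n))) :=
  (ENNReal.tendsto_toReal (measure_ne_top m _)).comp (tendsto_measure_iUnion_atTop hmono)

theorem tendsto_measureReal_iInter_atTop (m : Measure X) [IsFiniteMeasure m] {B : ℕ → Set X}
    (hB : ∀ n, NullMeasurableSet (B n) m) (hanti : Antitone B) :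
    Tendsto (fun n => m.real (B n)) atTop (𝓝 (m.real (⋂ n, B n))) :=
  (ENNReal.tendsto_toReal (measure_ne_top m _)).comp
    (tendsto_measure_iInter_atTop hB hanti ⟨0, measure_ne_top m _⟩)

theorem submodularLSC_measureReal (m : Measure X) [IsFiniteMeasure m] : SubmodularLSC m.real where
  nonneg _ := measureReal_nonneg
  union_add_inter_le _ hB := (measureReal_union_add_inter hB).le
  leLiminf_iUnion _ hmono := .of_tendsto (tendsto_measureReal_iUnion_atTop m hmono)
  leLiminf_iInter hB hanti :=
    .of_tendsto (tendsto_measureReal_iInter_atTop m (fun n => (hB n).nullMeasurableSet) hanti)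

theorem ae_le_of_measureReal_compl_le {m : Measure X} [IsFiniteMeasure m] {A M : Set X}
    (hA : MeasurableSet A) (h : m.real Mᶜ ≤ m.real (M ∪ A)ᶜ) : A ≤ᵐ[m] M := by
  have hsplit := measureReal_inter_add_sdiff (μ := m) (s := Mᶜ) hA
  rw [compl_union, ← sdiff_eq] at h
  rw [ae_le_set, ← measureReal_eq_zero_iff, sdiff_eq, inter_comm]
  exact le_antisymm (by linarith) measureReal_nonneg

namespace SubmodularLSC

variable {Φ : Set X → ℝ}

theorem exists_ae_greatest_minimizer (hΦ : SubmodularLSC Φ) (ν : Measure X) [SFinite ν] :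
    ∃ M ∈ minimizers Φ, ∀ A ∈ minimizers Φ, A ≤ᵐ[ν] M := by
  obtain ⟨M, hM, hMin⟩ := (submodularLSC_measureReal ν.toFinite).compl.exists_forall_le
    hΦ.isSigmaLattice_minimizers hΦ.nonempty_minimizers
  refine ⟨M, hM, fun A hA => ?_⟩
  have hAM : A ≤ᵐ[ν.toFinite] M := ae_le_of_measureReal_compl_le hA.1
    (hMin _ (hΦ.isSigmaLattice_minimizers.union_mem hM hA))
  exact (absolutelyContinuous_toFinite ν).ae_le hAM

theorem exists_ae_least_minimizer (hΦ : SubmodularLSC Φ) (ν : Measure X) [SFinite ν] :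
    ∃ M ∈ minimizers Φ, ∀ A ∈ minimizers Φ, M ≤ᵐ[ν] A := by
  obtain ⟨M, hM, h⟩ := hΦ.compl.exists_ae_greatest_minimizer ν
  refine ⟨Mᶜ, by rwa [← compl_mem_minimizers, compl_compl], fun A hA => ?_⟩
  simpa only [compl_compl] using (h _ (compl_mem_minimizers.2 hA)).compl

end SubmodularLSC

theorem nuEquiv_iff {ν : Measure X} {A B : Set X} : NuEquiv ν A B ↔ A =ᵐ[ν] B :=
  measure_symmDiff_eq_zero_iff

theorem nuLE_iff {ν : Measure X} {A B : Set X} : NuLE ν A B ↔ A ≤ᵐ[ν] B := by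
  refine eventually_congr (.of_forall fun x => ?_)
  change ind A x ≤ ind B x ↔ (x ∈ A → x ∈ B)
  by_cases hA : x ∈ A <;> by_cases hB : x ∈ B <;> simp [ind, hA, hB]

/-- The infimum of a set functional over the measurable sets in a `ν`-equivalence class, which turns
the pre-perimeter into the perimeter. -/
noncomputable def classInf (ν : Measure X) (Φ : Set X → ℝ) (A : Set X) : ℝ :=
  ⨅ B : {B : Set X // MeasurableSet B ∧ NuEquiv ν A B}, Φ (B : Set X)

theorem classInf_compl (ν : Measure X) (Φ : Set X → ℝ) (A : Set X) :
    classInf ν (fun B => Φ Bᶜ) Aᶜ = classInf ν Φ A := by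
  have hcompl : ∀ {A B : Set X}, MeasurableSet B ∧ NuEquiv ν A B →
      MeasurableSet Bᶜ ∧ NuEquiv ν Aᶜ Bᶜ := fun h =>
    ⟨h.1.compl, nuEquiv_iff.2 (nuEquiv_iff.1 h.2).compl⟩
  exact Equiv.iInf_congr
    { toFun := fun B => ⟨(B : Set X)ᶜ, by simpa only [compl_compl] using hcompl B.2⟩
      invFun := fun B => ⟨(B : Set X)ᶜ, hcompl B.2⟩
      left_inv := fun B => Subtype.ext (compl_compl (B : Set X))
      right_inv := fun B => Subtype.ext (compl_compl (B : Set X)) }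
    fun _ => rfl

namespace SubmodularLSC

variable {Φ : Set X → ℝ} {ν : Measure X}

theorem classInf_le (hΦ : SubmodularLSC Φ) {A B : Set X} (hB : MeasurableSet B)
    (h : A =ᵐ[ν] B) : classInf ν Φ A ≤ Φ B :=
  ciInf_le (f := fun B : {B : Set X // MeasurableSet B ∧ NuEquiv ν A B} => Φ (B : Set X))
    ⟨0, forall_mem_range.2 fun C => hΦ.nonneg C.2.1⟩ ⟨B, hB, nuEquiv_iff.2 h⟩

theorem exists_eq_classInf (hΦ : SubmodularLSC Φ) (ν : Measure X) {A : Set X}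
    (hA : MeasurableSet A) : ∃ B, MeasurableSet B ∧ A =ᵐ[ν] B ∧ Φ B = classInf ν Φ A := by
  obtain ⟨C, ⟨hC, hAC⟩, hmin⟩ :=
    hΦ.exists_forall_le (isSigmaLattice_ae_eq ν A) ⟨A, hA, EventuallyEq.rfl⟩
  have : Nonempty {B : Set X // MeasurableSet B ∧ NuEquiv ν A B} := ⟨⟨C, hC, nuEquiv_iff.2 hAC⟩⟩
  exact ⟨C, hC, hAC, le_antisymm (le_ciInf fun B => hmin B ⟨B.2.1, nuEquiv_iff.1 B.2.2⟩)
    (hΦ.classInf_le hC hAC)⟩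

theorem exists_monotone_le_classInf (hΦ : SubmodularLSC Φ) (ν : Measure X) {A : ℕ → Set X}
    (hA : ∀ n, MeasurableSet (A n)) (hmono : Monotone A) :
    ∃ C : ℕ → Set X, Monotone C ∧
      ∀ n, MeasurableSet (C n) ∧ A n =ᵐ[ν] C n ∧ Φ (C n) ≤ classInf ν Φ (A n) := by
  choose B hB hAB hBΦ using fun n => hΦ.exists_eq_classInf ν (hA n)
  refine ⟨accumulate B, monotone_accumulate, fun n => ?_⟩
  induction n with
  | zero =>
    rw [accumulate_zero_nat]
    exact ⟨hB 0, hAB 0, (hBΦ 0).le⟩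
  | succ n ih =>
    obtain ⟨hC, hAC, hCΦ⟩ := ih
    have hunion : A (n + 1) =ᵐ[ν] (accumulate B n ∪ B (n + 1) : Set X) := by
      simpa only [union_eq_self_of_subset_left (hmono n.le_succ)] using hAC.union (hAB (n + 1))
    have hinter : A n =ᵐ[ν] (accumulate B n ∩ B (n + 1) : Set X) := by
      simpa only [inter_eq_self_of_subset_left (hmono n.le_succ)] using hAC.inter (hAB (n + 1))
    rw [accumulate_succ]
    refine ⟨hC.union (hB _), hunion, ?_⟩
    linarith [hΦ.union_add_inter_le hC (hB (n + 1)), hBΦ (n + 1),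
      hΦ.classInf_le (hC.inter (hB (n + 1))) hinter]

theorem leLiminf_classInf_iUnion (hΦ : SubmodularLSC Φ) (ν : Measure X) {A : ℕ → Set X}
    (hA : ∀ n, MeasurableSet (A n)) (hmono : Monotone A) :
    LeLiminf (classInf ν Φ (⋃ n, A n)) (fun n => classInf ν Φ (A n)) atTop := by
  obtain ⟨C, hCmono, hC⟩ := hΦ.exists_monotone_le_classInf ν hA hmono
  have hUnion : classInf ν Φ (⋃ n, A n) ≤ Φ (⋃ n, C n) :=
    hΦ.classInf_le (.iUnion fun n => (hC n).1)
      (Filter.EventuallyEq.countable_iUnion fun n => (hC n).2.1)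
  intro c hc
  exact (hΦ.leLiminf_iUnion (fun n => (hC n).1) hCmono).mono (fun n => (hC n).2.2) c
    (hc.trans_le hUnion)

theorem classInf (hΦ : SubmodularLSC Φ) (ν : Measure X) : SubmodularLSC (classInf ν Φ) where
  nonneg _ := Real.iInf_nonneg fun B => hΦ.nonneg B.2.1
  union_add_inter_le hA hA' := by
    obtain ⟨B, hB, hAB, h⟩ := hΦ.exists_eq_classInf ν hA
    obtain ⟨B', hB', hAB', h'⟩ := hΦ.exists_eq_classInf ν hA'
    linarith [hΦ.union_add_inter_le hB hB', hΦ.classInf_le (hB.union hB') (hAB.union hAB'),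
      hΦ.classInf_le (hB.inter hB') (hAB.inter hAB')]
  leLiminf_iUnion hA hmono := hΦ.leLiminf_classInf_iUnion ν hA hmono
  leLiminf_iInter hA hanti := by
    simp_rw [← classInf_compl ν Φ, compl_iInter]
    exact hΦ.compl.leLiminf_classInf_iUnion ν (fun n => (hA n).compl)
      fun _ _ h => compl_subset_compl.2 (hanti h)

end SubmodularLSC

section Thickening

open Metric

theorem submodularLSC_measureReal_thickening_sub {X : Type*} [PseudoEMetricSpace X]
    [MeasurableSpace X] [OpensMeasurableSpace X] (m : Measure X) [IsFiniteMeasure m] {ε : ℝ}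
    (hε : 0 < ε) : SubmodularLSC (fun A => m.real (thickening ε A) - m.real A) where
  nonneg _ := sub_nonneg.2 (measureReal_mono (self_subset_thickening hε _))
  union_add_inter_le {A B} _ hB := by
    have hinter : m.real (thickening ε (A ∩ B)) ≤ m.real (thickening ε A ∩ thickening ε B) :=
      measureReal_mono (subset_inter (thickening_subset_of_subset ε inter_subset_left)
        (thickening_subset_of_subset ε inter_subset_right))
    have hthick := measureReal_union_add_inter (μ := m) (s := thickening ε A)
      (isOpen_thickening (δ := ε) (E := B)).measurableSet
    rw [← thickening_union] at hthick
    linarith [measureReal_union_add_inter (μ := m) (s := A) hB]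
  leLiminf_iUnion _ hmono := by
    rw [thickening_iUnion]
    exact .of_tendsto ((tendsto_measureReal_iUnion_atTop m fun _ _ h =>
      thickening_subset_of_subset ε (hmono h)).sub (tendsto_measureReal_iUnion_atTop m hmono))
  leLiminf_iInter hB hanti := by
    refine (LeLiminf.of_tendsto ((tendsto_measureReal_iInter_atTop m
      (fun n => (hB n).nullMeasurableSet) hanti).const_sub _)).mono fun n => ?_
    exact sub_le_sub_right
      (measureReal_mono (thickening_subset_of_subset ε (iInter_subset _ n))) _

end Thickening

section Indicator

theorem ind_of_mem {X : Type*} {A : Set X} {x : X} (hx : x ∈ A) : ind A x = 1 :=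
  indicator_of_mem hx _

theorem ind_of_notMem {X : Type*} {A : Set X} {x : X} (hx : x ∉ A) : ind A x = 0 :=
  indicator_of_notMem hx _

theorem ind_le_one {X : Type*} (A : Set X) (x : X) : ind A x ≤ 1 :=
  indicator_le_self' (fun _ _ => zero_le_one) x

theorem ind_compl {X : Type*} (A : Set X) (x : X) : ind Aᶜ x = 1 - ind A x := by
  by_cases hx : x ∈ A <;> simp [ind, hx]

theorem integrable_ind {m : Measure X} [IsFiniteMeasure m] {A : Set X} (hA : MeasurableSet A) :
    Integrable (ind A) m :=
  (integrable_const 1).indicator hA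

theorem integral_ind {m : Measure X} {A : Set X} (hA : MeasurableSet A) :
    ∫ x, ind A x ∂m = m.real A :=
  integral_indicator_one hA

theorem integral_ind_sub_ind (m : Measure X) [IsFiniteMeasure m] {A B : Set X}
    (hA : MeasurableSet A) (hB : MeasurableSet B) :
    ∫ x, (ind A x - ind B x) ∂m = m.real A - m.real B := by
  rw [integral_sub (integrable_ind hA) (integrable_ind hB), integral_ind hA, integral_ind hB]

open Metric

variable {X : Type*} [PseudoMetricSpace X] {ε : ℝ}

theorem bddAbove_range_ind_ball (ε : ℝ) (A : Set X) (x : X) :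
    BddAbove (range fun z : ball x ε => ind A (z : X)) :=
  ⟨1, forall_mem_range.2 fun z => ind_le_one A z⟩

theorem iSup_ind_ball (hε : 0 < ε) (A : Set X) (x : X) :
    (⨆ z : ball x ε, ind A (z : X)) = ind (thickening ε A) x := by
  have : Nonempty (ball x ε) := ⟨⟨x, mem_ball_self hε⟩⟩
  by_cases hx : x ∈ thickening ε A
  · obtain ⟨z, hzA, hxz⟩ := mem_thickening_iff.1 hx
    rw [ind_of_mem hx]
    refine le_antisymm (ciSup_le fun z => ind_le_one A z) ?_
    simpa only [ind_of_mem hzA] using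
      le_ciSup (bddAbove_range_ind_ball ε A x) ⟨z, mem_ball'.2 hxz⟩
  · have hA : ∀ z : ball x ε, ind A (z : X) = 0 := fun z =>
      ind_of_notMem fun hz => hx (mem_thickening_iff.2 ⟨z, hz, mem_ball'.1 z.2⟩)
    simp only [hA, ciSup_const, ind_of_notMem hx]

theorem iInf_ind_ball (hε : 0 < ε) (A : Set X) (x : X) :
    (⨅ z : ball x ε, ind A (z : X)) = 1 - ind (thickening ε Aᶜ) x := by
  have : Nonempty (ball x ε) := ⟨⟨x, mem_ball_self hε⟩⟩
  have hsub : Antitone fun t : ℝ => 1 - t := fun _ _ h => sub_le_sub_left h 1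
  rw [← iSup_ind_ball hε, hsub.map_ciSup_of_continuousAt (by fun_prop)
    (bddAbove_range_ind_ball ε Aᶜ x)]
  simp only [ind_compl, sub_sub_cancel]

end Indicator

section Slice

/-- The unnormalized class measure `A ↦ μ (A × {i})`, that is `w_i ρ_i` in the notation of the
paper. -/
noncomputable def slice (μ : Measure (X × Fin 2)) (i : Fin 2) : Measure X :=
  (μ.restrict (univ ×ˢ {i})).map Prod.fst

variable (μ : Measure (X × Fin 2))

theorem slice_apply (i : Fin 2) {A : Set X} (hA : MeasurableSet A) :
    slice μ i A = μ (A ×ˢ {i}) := by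
  rw [slice, Measure.map_apply measurable_fst hA, Measure.restrict_apply (measurable_fst hA),
    ← prod_univ, prod_inter_prod, inter_univ, univ_inter]

variable [IsFiniteMeasure μ]

instance (i : Fin 2) : IsFiniteMeasure (slice μ i) :=
  inferInstanceAs (IsFiniteMeasure ((μ.restrict (univ ×ˢ {i})).map Prod.fst))

theorem classProb_mul_integral_condDist (i : Fin 2) (f : X → ℝ) :
    classProb μ i * ∫ x, f x ∂(condDist μ i) = ∫ x, f x ∂(slice μ i) := by
  rw [classProb, condDist, integral_smul_measure, smul_eq_mul, ← mul_assoc, ENNReal.toReal_inv]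
  by_cases h : μ (univ ×ˢ {i}) = 0
  · have hslice : slice μ i = 0 := by rw [slice, Measure.restrict_eq_zero.2 h, Measure.map_zero]
    simp [h, hslice]
  · rw [mul_inv_cancel₀ (ENNReal.toReal_ne_zero.2 ⟨h, measure_ne_top _ _⟩), one_mul, slice]

theorem risk_eq {A : Set X} (hA : MeasurableSet A) :
    risk μ A = (slice μ 0).real A + (slice μ 1).real Aᶜ := by
  have h0 : MeasurableSet (A ×ˢ {0} : Set (X × Fin 2)) := hA.prod (.singleton 0)
  have h1 : MeasurableSet (Aᶜ ×ˢ {1} : Set (X × Fin 2)) := hA.compl.prod (.singleton 1)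
  have hloss : ∀ p : X × Fin 2, |ind A p.1 - ((p.2 : ℕ) : ℝ)| =
      ind (A ×ˢ {0}) p + ind (Aᶜ ×ˢ {1}) p := by
    rintro ⟨x, i⟩
    by_cases hx : x ∈ A <;> fin_cases i <;> simp [ind, hx, indicator]
  simp_rw [risk, hloss]
  rw [integral_add (integrable_ind h0) (integrable_ind h1), integral_ind h0, integral_ind h1]
  simp_rw [measureReal_def, slice_apply μ _ hA, slice_apply μ _ hA.compl]

theorem submodularLSC_risk : SubmodularLSC (risk μ) :=
  ((submodularLSC_measureReal (slice μ 0)).add (submodularLSC_measureReal (slice μ 1)).compl).congr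
    fun _ hA => risk_eq μ hA

end Slice

section Objective

open Metric

variable {X : Type*} [MetricSpace X] [MeasurableSpace X] [OpensMeasurableSpace X]
  (μ : Measure (X × Fin 2)) [IsFiniteMeasure μ] {ε : ℝ}

theorem prePer_eq (hε : 0 < ε) {A : Set X} (hA : MeasurableSet A) :
    prePer ε μ A = ε⁻¹ *
      (((slice μ 0).real (thickening ε A) - (slice μ 0).real A) +
        ((slice μ 1).real (thickening ε Aᶜ) - (slice μ 1).real Aᶜ)) := by
  have hinner : ∀ x, ind A x - ⨅ z : ball x ε, ind A (z : X) =
      ind (thickening ε Aᶜ) x - ind Aᶜ x := fun x => by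
    rw [iInf_ind_ball hε, ind_compl]
    ring
  simp_rw [prePer, hinner, iSup_ind_ball hε]
  rw [← integral_ind_sub_ind _ isOpen_thickening.measurableSet hA,
    ← integral_ind_sub_ind _ isOpen_thickening.measurableSet hA.compl,
    ← classProb_mul_integral_condDist, ← classProb_mul_integral_condDist]
  ring

theorem submodularLSC_prePer (hε : 0 < ε) : SubmodularLSC (prePer ε μ) :=
  (((submodularLSC_measureReal_thickening_sub (slice μ 0) hε).add
    (submodularLSC_measureReal_thickening_sub (slice μ 1) hε).compl).const_mul
      (inv_nonneg.2 hε.le)).congr fun _ hA => prePer_eq μ hε hA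

theorem submodularLSC_objective (ν : Measure X) (hε : 0 < ε) : SubmodularLSC (objective ν ε μ) :=
  (submodularLSC_risk μ).add (((submodularLSC_prePer μ hε).classInf ν).const_mul hε.le)

end Objective

end AdvTraining

open AdvTraining in
theorem mainTheorem7_general {X : Type*} [MetricSpace X] [MeasurableSpace X]
    [OpensMeasurableSpace X] (μ : Measure (X × Fin 2)) [IsFiniteMeasure μ] (ν : Measure X)
    [SFinite ν] (ε : ℝ) (hε : 0 < ε) :
    (∃ A : Set X, IsMaximalSolution ν ε μ A ∧
      ∀ A' : Set X, IsMaximalSolution ν ε μ A' → NuEquiv ν A A') ∧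
    (∃ A : Set X, IsMinimalSolution ν ε μ A ∧
      ∀ A' : Set X, IsMinimalSolution ν ε μ A' → NuEquiv ν A A') := by
  have hJ := submodularLSC_objective μ ν hε
  simp only [IsMaximalSolution, IsMinimalSolution, nuEquiv_iff, nuLE_iff]
  constructor
  · obtain ⟨M, hM, hgreatest⟩ := hJ.exists_ae_greatest_minimizer ν
    exact ⟨M, ⟨hM, fun A hA hMA => hMA.antisymm (hgreatest A hA)⟩,
      fun A hA => (hA.2 M hM (hgreatest A hA.1)).symm⟩
  · obtain ⟨M, hM, hleast⟩ := hJ.exists_ae_least_minimizer ν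
    exact ⟨M, ⟨hM, fun A hA hAM => (hleast A hA).antisymm hAM⟩,
      fun A hA => (hA.2 M hM (hleast A hA.1)).symm⟩

theorem mainTheorem7 {X : Type*} [MetricSpace X] [TopologicalSpace.SeparableSpace X]
    [MeasurableSpace X] [BorelSpace X]
    (μ : Measure (X × Fin 2)) [IsProbabilityMeasure μ]
    (ν : Measure X) [IsFiniteMeasure ν]
    (ε : ℝ) (hε : 0 < ε) :
    (∃ A : Set X, AdvTraining.IsMaximalSolution ν ε μ A ∧
      ∀ A' : Set X, AdvTraining.IsMaximalSolution ν ε μ A' → AdvTraining.NuEquiv ν A A') ∧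
    (∃ A : Set X, AdvTraining.IsMinimalSolution ν ε μ A ∧
      ∀ A' : Set X, AdvTraining.IsMinimalSolution ν ε μ A' → AdvTraining.NuEquiv ν A A') :=
  mainTheorem7_general μ ν ε hε
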